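/- Let $H$ be a complex Hilbert space and let $A:\mathfrak D(A)\subset H\to H$ be a strictly positive selfadjoint (possibly unbounded) operator, i.e. $A=A^*$ and $\langle Au,u\rangle\ge c\|u\|^2$ on $\mathfrak D(A)$ for some $c>0$. Let $\theta\in\mathbb R$. Let $H^1=\mathfrak D(A^{1/2})$ with norm $\|A^{1/2}u\|$, and let $\mathcal H=H^1\times H$ with the norm $\|(u,v)\|_{\mathcal H}^2=\|A^{1/2}u\|^2+\|v\|^2$. Consider the operator $$\mathbb A_\theta(u,v)=(v,\,-Au-A^\theta v),\qquad \mathfrak D(\mathbb A_\theta)=\{(u,v)\in\mathcal H:\ v\in H^1,\ Au+A^\theta v\in H\},$$ where, for $u,v\in H$, $Au$ and $A^\theta v$ denote the functionals $w\mapsto\langle Aw,u\rangle$ on $\mathfrak D(A)$ and $w\mapsto\langle A^\theta w,v\rangle$ on $\mathfrak D(A^\theta)$, and $Au+A^\theta v\in H$ means that their sum on $\mathfrak D(A)\cap\mathfrak D(A^\theta)$ is $w\mapsto\langle w,h\rangle$ for some (necessarily unique) $h\in H$, which is then denoted $Au+A^\theta v$. Write $\sigma(\cdot)$ for the spectrum;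 $\sigma(A)\subset(0,\infty)$. For $s\in\sigma(A)$ set $$\xi_s^{\pm}=\begin{cases}-\dfrac{s^\theta}{2}\pm\dfrac{\sqrt{s^{2\theta}-4s}}{2}&\text{if } s^{\theta-1/2}\ge 2,\\[2mm]-\dfrac{s^\theta}{2}\pm i\,\dfrac{\sqrt{4s-s^{2\theta}}}{2}&\text{if } s^{\theta-1/2}<2.\end{cases}$$ Then the following hold. (i) The operator $\mathbb A_\theta:\mathfrak D(\mathbb A_\theta)\to\mathcal H$ is bijective if and only if $\theta\le 1$ or $A$ is a bounded operator. (ii) We have $$\sigma(\mathbb A_\theta)\setminus\{0\}=\begin{cases}\displaystyle\bigcup_{s\in\sigma(A)}\{\xi_s^+,\xi_s^-\}\cup\{-1\}&\text{if }\theta=1\text{ and }A\text{ is unbounded},\\[2mm]\displaystyle\bigcup_{s\in\sigma(A)}\{\xi_s^+,\xi_s^-\}&\text{otherwise.}\end{cases}$$ -/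

import Mathlib

noncomputable section

namespace DampedWave

/-! ### Unbounded operators and their spectra -/

/-- The resolvent set of a (possibly unbounded) operator `T` : the numbers `ξ` such that
`ξ - T : D(T) → E` is a bijection with bounded inverse. -/
def resolventSet {E : Type*} [NormedAddCommGroup E] [NormedSpace ℂ E] (T : E →ₗ.[ℂ] E) : Set ℂ :=
  {ξ | ∃ R : E →L[ℂ] E,
    (∀ y : E, ∃ h : R y ∈ T.domain, ξ • R y - T ⟨R y, h⟩ = y) ∧
    ∀ x : T.domain, R (ξ • (x : E) - T x) = x}

/-- The spectrum of a (possibly unbounded) operator. -/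
def spectrum {E : Type*} [NormedAddCommGroup E] [NormedSpace ℂ E] (T : E →ₗ.[ℂ] E) : Set ℂ :=
  (resolventSet T)ᶜ

/-- `T` is an everywhere defined bounded operator. -/
def IsBoundedOperator {E : Type*} [NormedAddCommGroup E] [NormedSpace ℂ E]
    (T : E →ₗ.[ℂ] E) : Prop :=
  T.domain = ⊤ ∧ ∃ C : ℝ, ∀ x : T.domain, ‖T x‖ ≤ C * ‖(x : E)‖

/-- A strictly positive selfadjoint (in general unbounded) operator on a complex Hilbert space. -/
structure StrictlyPositiveOperator (H : Type*) [NormedAddCommGroup H] [InnerProductSpace ℂ H]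
    [CompleteSpace H] where
  /-- the underlying partially defined linear map -/
  op : H →ₗ.[ℂ] H
  isSelfAdjoint : IsSelfAdjoint op
  strictlyPositive : ∃ c : ℝ, 0 < c ∧
    ∀ x : op.domain, c * ‖(x : H)‖ ^ 2 ≤ (inner ℂ (op x) (x : H)).re

namespace StrictlyPositiveOperator

variable {H : Type*} [NormedAddCommGroup H] [InnerProductSpace ℂ H] [CompleteSpace H]
  (A : StrictlyPositiveOperator H)

/-! ### The bounded inverse -/

theorem exists_bound : ∃ c : ℝ, 0 < c ∧ ∀ x : A.op.domain, c * ‖(x : H)‖ ≤ ‖A.op x‖ := by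
  obtain ⟨c, hc, h⟩ := A.strictlyPositive
  refine ⟨c, hc, fun x => ?_⟩
  have h1 := h x
  have h2 : (inner ℂ (A.op x) (x : H)).re ≤ ‖A.op x‖ * ‖(x : H)‖ :=
    re_inner_le_norm (𝕜 := ℂ) _ _
  rcases (norm_nonneg (x : H)).eq_or_lt with h0 | h0
  · rw [← h0]; simp
  · have : (c * ‖(x : H)‖) * ‖(x : H)‖ ≤ ‖A.op x‖ * ‖(x : H)‖ := by nlinarith
    exact le_of_mul_le_mul_right this h0

theorem symm (x y : A.op.domain) : inner ℂ (A.op x) (y : H) = inner ℂ (x : H) (A.op y) := by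
  have h := LinearPMap.adjoint_isFormalAdjoint (T := A.op) A.isSelfAdjoint.dense_domain
  rw [LinearPMap.isSelfAdjoint_def.mp A.isSelfAdjoint] at h
  exact h x y

theorem mem_of_inner {x y : H} (h : ∀ w : A.op.domain, inner ℂ y (w : H) = inner ℂ x (A.op w)) :
    ∃ hx : x ∈ A.op.domain, A.op ⟨x, hx⟩ = y := by
  have hd := A.isSelfAdjoint.dense_domain
  have e := LinearPMap.isSelfAdjoint_def.mp A.isSelfAdjoint
  have hx' : x ∈ A.op.adjoint.domain := LinearPMap.mem_adjoint_domain_of_exists (T := A.op) x ⟨y, h⟩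
  have hx : x ∈ A.op.domain := by rwa [e] at hx'
  refine ⟨hx, hd.eq_of_inner_left ℂ fun v hv => ?_⟩
  rw [h ⟨v, hv⟩, A.symm ⟨x, hx⟩ ⟨v, hv⟩]

theorem bijective : Function.Bijective A.op.toFun := by
  obtain ⟨c, hc, hb⟩ := A.exists_bound
  have hinj : Function.Injective A.op.toFun := by
    rw [← LinearMap.ker_eq_bot, LinearMap.ker_eq_bot']
    intro x hx
    have h1 := hb x
    have h2 : A.op x = 0 := hx
    rw [h2, norm_zero] at h1
    have h3 : ‖(x : H)‖ = 0 := by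
      have := norm_nonneg (x : H)
      nlinarith
    exact Subtype.ext (norm_eq_zero.mp h3)
  refine ⟨hinj, ?_⟩
  have hclosed : IsClosed (LinearMap.range A.op.toFun : Set H) := by
    refine isClosed_of_closure_subset fun y hy => ?_
    obtain ⟨s, hs, hlim⟩ := mem_closure_iff_seq_limit.mp hy
    choose x hx using hs
    have hcau : CauchySeq fun n => (x n : H) := by
      have hs := hlim.cauchySeq
      rw [Metric.cauchySeq_iff] at hs ⊢
      intro ε hε
      obtain ⟨N, hN⟩ := hs (c * ε) (by positivity)
      refine ⟨N, fun m hm n hn => ?_⟩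
      have h1 := hN m hm n hn
      have h2 := hb (x m - x n)
      rw [dist_eq_norm, ← hx m, ← hx n, ← map_sub] at h1
      have h3 : c * ‖((x m - x n : A.op.domain) : H)‖ < c * ε := lt_of_le_of_lt h2 h1
      rw [dist_eq_norm]
      exact lt_of_mul_lt_mul_left h3 hc.le
    obtain ⟨z, hz⟩ := cauchySeq_tendsto_of_complete hcau
    obtain ⟨hzd, hzA⟩ := A.mem_of_inner (x := z) (y := y) fun w => by
      refine tendsto_nhds_unique (hlim.inner tendsto_const_nhds)
        (Filter.Tendsto.congr (fun n => ?_) (hz.inner tendsto_const_nhds))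
      rw [← hx n]
      exact (A.symm (x n) w).symm
    exact ⟨⟨z, hzd⟩, hzA⟩
  have horth : (LinearMap.range A.op.toFun)ᗮ = ⊥ := by
    rw [Submodule.eq_bot_iff]
    intro y hy
    obtain ⟨hyd, hyA⟩ := A.mem_of_inner (x := y) (y := 0) fun w => by
      rw [inner_zero_left]
      exact (Submodule.inner_left_of_mem_orthogonal (LinearMap.mem_range_self A.op.toFun w) hy).symm
    have : (⟨y, hyd⟩ : A.op.domain) = 0 := hinj (hyA.trans (map_zero A.op.toFun).symm)
    exact congrArg Subtype.val this
  have : CompleteSpace (LinearMap.range A.op.toFun) := hclosed.completeSpace_coe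
  exact LinearMap.range_eq_top.mp (Submodule.orthogonal_eq_bot_iff.mp horth)

/-- The bounded inverse `A⁻¹` of a strictly positive selfadjoint operator `A`. -/
def inv : H →L[ℂ] H :=
  LinearMap.mkContinuousOfExistsBound
    (A.op.domain.subtype ∘ₗ (LinearEquiv.ofBijective A.op.toFun A.bijective).symm.toLinearMap) (by
      obtain ⟨c, hc, hb⟩ := A.exists_bound
      refine ⟨c⁻¹, fun y => ?_⟩
      have h := hb ((LinearEquiv.ofBijective A.op.toFun A.bijective).symm y)
      have e : A.op ((LinearEquiv.ofBijective A.op.toFun A.bijective).symm y) = y :=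
        (LinearEquiv.ofBijective A.op.toFun A.bijective).apply_symm_apply y
      rw [e] at h
      rw [inv_mul_eq_div, le_div_iff₀' hc]
      exact h)

theorem inv_mem (y : H) : A.inv y ∈ A.op.domain :=
  ((LinearEquiv.ofBijective A.op.toFun A.bijective).symm y).2

theorem op_inv (y : H) : A.op ⟨A.inv y, A.inv_mem y⟩ = y :=
  (LinearEquiv.ofBijective A.op.toFun A.bijective).apply_symm_apply y

theorem inv_op (x : A.op.domain) : A.inv (A.op x) = x :=
  congrArg Subtype.val ((LinearEquiv.ofBijective A.op.toFun A.bijective).symm_apply_apply x)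

theorem inv_injective : Function.Injective A.inv := by
  rw [injective_iff_map_eq_zero]
  intro y hy
  have h1 := A.op_inv y
  have h2 : (⟨A.inv y, A.inv_mem y⟩ : A.op.domain) = 0 := Subtype.ext hy
  rw [h2, LinearPMap.map_zero] at h1
  exact h1.symm

theorem inv_nonneg : 0 ≤ A.inv := by
  rw [ContinuousLinearMap.nonneg_iff_isPositive,
    ContinuousLinearMap.isPositive_iff_complex]
  intro y
  have key : inner ℂ (A.inv y) y = inner ℂ (A.op ⟨A.inv y, A.inv_mem y⟩) (A.inv y) := by
    have h := A.symm ⟨A.inv y, A.inv_mem y⟩ ⟨A.inv y, A.inv_mem y⟩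
    rw [h, A.op_inv]
  have hconj : (starRingEnd ℂ) (inner ℂ (A.inv y) y) = inner ℂ (A.inv y) y := by
    rw [inner_conj_symm, key, A.op_inv]
  refine ⟨Complex.conj_eq_iff_re.mp hconj, ?_⟩
  rw [key]
  obtain ⟨c, hc, h⟩ := A.strictlyPositive
  exact le_trans (by positivity) (h ⟨A.inv y, A.inv_mem y⟩)

/-! ### Fractional powers -/

theorem inv_rpow_add {s t : ℝ} (hs : 0 ≤ s) (ht : 0 ≤ t) :
    A.inv ^ (s + t) = A.inv ^ s * A.inv ^ t := by
  rw [CFC.rpow_def, CFC.rpow_def, CFC.rpow_def, ← cfc_mul _ _ A.inv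
    (NNReal.continuous_rpow_const hs).continuousOn (NNReal.continuous_rpow_const ht).continuousOn]
  exact cfc_congr fun x _ => NNReal.rpow_add_of_nonneg x hs ht

theorem inv_rpow_injective {t : ℝ} (ht : 0 ≤ t) : Function.Injective (A.inv ^ t) := by
  obtain ⟨n, hn⟩ := exists_nat_ge t
  have h1 : A.inv ^ n = A.inv ^ ((n : ℝ) - t) * A.inv ^ t := by
    rw [← A.inv_rpow_add (sub_nonneg.mpr hn) ht, sub_add_cancel,
      CFC.rpow_natCast A.inv n A.inv_nonneg]
  have h2 : Function.Injective (A.inv ^ n) := by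
    have h3 : ⇑(A.inv ^ n) = A.inv^[n] := funext fun x => by rw [FunLike.coe_pow_eq_iterate]
    rw [h3]
    exact A.inv_injective.iterate n
  rw [h1] at h2
  exact Function.Injective.of_comp (f := (A.inv ^ ((n : ℝ) - t) : H →L[ℂ] H)) h2

/-- The fractional power `A ^ θ`, `θ : ℝ`: for `t ≥ 0` the operator `A ^ (-t)` is the bounded
operator `(A⁻¹) ^ t`, given by the continuous functional calculus of `A⁻¹`; for `t > 0` the
operator `A ^ t` is the inverse of the injective operator `A ^ (-t)`, with domain the range of
`A ^ (-t)`. -/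
def fracPow (θ : ℝ) : H →ₗ.[ℂ] H :=
  if 0 < θ then ((A.inv ^ θ : H →L[ℂ] H).toLinearMap.toPMap ⊤).inverse
  else (A.inv ^ (-θ) : H →L[ℂ] H).toLinearMap.toPMap ⊤

theorem fracPow_mem_graph_iff {θ : ℝ} (hθ : 0 < θ) (x y : H) :
    (x, y) ∈ (A.fracPow θ).graph ↔ (A.inv ^ θ) y = x := by
  have hk : LinearMap.ker ((A.inv ^ θ : H →L[ℂ] H).toLinearMap.toPMap ⊤).toFun = ⊥ := by
    rw [LinearMap.ker_eq_bot']
    intro m hm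
    have : (A.inv ^ θ) (m : H) = (A.inv ^ θ) 0 := by rw [map_zero]; exact hm
    exact Subtype.ext (A.inv_rpow_injective hθ.le this)
  rw [fracPow, if_pos hθ, LinearPMap.inverse_graph hk]
  simp [LinearPMap.mem_graph_iff]

theorem fracPow_rpow {θ : ℝ} (hθ : 0 < θ) (y : H) :
    ∃ h : (A.inv ^ θ) y ∈ (A.fracPow θ).domain, A.fracPow θ ⟨(A.inv ^ θ) y, h⟩ = y := by
  have := (A.fracPow_mem_graph_iff hθ _ y).mpr rfl
  obtain ⟨z, h1, h2⟩ := (LinearPMap.mem_graph_iff _).mp this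
  dsimp only at h1 h2
  have hz : (A.inv ^ θ) y ∈ (A.fracPow θ).domain := by rw [← h1]; exact z.2
  refine ⟨hz, ?_⟩
  refine Eq.trans ?_ h2
  congr 1
  exact Subtype.ext h1.symm

theorem rpow_fracPow {θ : ℝ} (hθ : 0 < θ) (x : (A.fracPow θ).domain) :
    (A.inv ^ θ) (A.fracPow θ x) = x :=
  (A.fracPow_mem_graph_iff hθ _ _).mp (LinearPMap.mem_graph _ x)

/-- The first power is the operator itself. -/
theorem fracPow_one : A.fracPow 1 = A.op := by
  refine LinearPMap.eq_of_eq_graph (Submodule.ext fun ⟨x, y⟩ => ?_)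
  rw [A.fracPow_mem_graph_iff one_pos, CFC.rpow_one A.inv A.inv_nonneg, LinearPMap.mem_graph_iff]
  constructor
  · rintro rfl
    exact ⟨⟨A.inv y, A.inv_mem y⟩, rfl, A.op_inv y⟩
  · rintro ⟨z, h1, h2⟩
    dsimp only at h1 h2
    rw [← h1, ← h2]
    exact A.inv_op z

/-! ### The phase space -/

/-- The space `H¹ = D(A ^ (1/2))`, to be normed by `‖A ^ (1/2) u‖`. -/
def EnergySpace : Type _ := (A.fracPow (1 / 2)).domain

instance : AddCommGroup A.EnergySpace := inferInstanceAs (AddCommGroup (A.fracPow (1 / 2)).domain)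

instance : Module ℂ A.EnergySpace := inferInstanceAs (Module ℂ (A.fracPow (1 / 2)).domain)

/-- The inclusion `H¹ ⊆ H`. -/
def incl : A.EnergySpace →ₗ[ℂ] H := (A.fracPow (1 / 2)).domain.subtype

theorem incl_injective : Function.Injective A.incl := Subtype.val_injective

/-- The operator `A ^ (1/2)` on `H¹`. -/
def sqrtOp : A.EnergySpace →ₗ[ℂ] H := (A.fracPow (1 / 2)).toFun

theorem sqrtOp_eq_zero {u : A.EnergySpace} (h : A.sqrtOp u = 0) : u = 0 := by
  have h1 := A.rpow_fracPow (θ := 1 / 2) (by norm_num) u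
  have h2 : A.fracPow (1 / 2) u = 0 := h
  rw [h2, map_zero] at h1
  exact Subtype.ext h1.symm

/-- The inner product `⟨u, v⟩₁ = ⟨A ^ (1/2) u, A ^ (1/2) v⟩` on `H¹`. -/
@[reducible] def energyCore : InnerProductSpace.Core ℂ A.EnergySpace where
  inner u v := inner ℂ (A.sqrtOp u) (A.sqrtOp v)
  conj_inner_symm u v := inner_conj_symm _ _
  re_inner_nonneg u := inner_self_nonneg
  add_left u v w := by rw [map_add, inner_add_left]
  smul_left u v r := by rw [map_smul, inner_smul_left]
  definite u h := A.sqrtOp_eq_zero (inner_self_eq_zero.mp h)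

instance : NormedAddCommGroup A.EnergySpace := A.energyCore.toNormedAddCommGroup

instance : InnerProductSpace ℂ A.EnergySpace := InnerProductSpace.ofCore A.energyCore.toCore

/-- The phase space `H¹ × H` with the norm `‖(u, v)‖² = ‖A ^ (1/2) u‖² + ‖v‖²`. -/
abbrev PhaseSpace : Type _ := WithLp 2 (A.EnergySpace × H)

/-! ### The generator -/

/-- `A u + A ^ θ v = h`, where `A u` and `A ^ θ v` are understood as the functionals
`w ↦ ⟨A w, u⟩` on `D(A)` and `w ↦ ⟨A ^ θ w, v⟩` on `D(A ^ θ)`, whose sum acts on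
`D(A) ∩ D(A ^ θ)`, and where `h : H` is understood as the functional `w ↦ ⟨w, h⟩`. -/
def WeakSum (θ : ℝ) (u v h : H) : Prop :=
  ∀ (w : H) (h₁ : w ∈ A.op.domain) (h₂ : w ∈ (A.fracPow θ).domain),
    inner ℂ (A.op ⟨w, h₁⟩) u + inner ℂ (A.fracPow θ ⟨w, h₂⟩) v = inner ℂ w h

variable {A}

theorem WeakSum.add {θ : ℝ} {u v h u' v' h' : H} (H₁ : A.WeakSum θ u v h)
    (H₂ : A.WeakSum θ u' v' h') : A.WeakSum θ (u + u') (v + v') (h + h') := by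
  intro w h₁ h₂
  simp only [inner_add_right, ← H₁ w h₁ h₂, ← H₂ w h₁ h₂]
  ring

theorem WeakSum.smul {θ : ℝ} {u v h : H} (c : ℂ) (H₁ : A.WeakSum θ u v h) :
    A.WeakSum θ (c • u) (c • v) (c • h) := by
  intro w h₁ h₂
  simp only [inner_smul_right, ← H₁ w h₁ h₂]
  ring

theorem WeakSum.unique {θ : ℝ} {u v h h' : H} (H₁ : A.WeakSum θ u v h)
    (H₂ : A.WeakSum θ u v h') : h = h' := by
  set t : ℝ := max θ 0 with ht
  have ht0 : 0 ≤ t := le_max_right _ _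
  have hs : IsSelfAdjoint (A.inv ^ (1 + t)) := IsSelfAdjoint.of_nonneg CFC.rpow_nonneg
  refine A.inv_rpow_injective (t := 1 + t) (by positivity) (ext_inner_left ℂ fun y => ?_)
  have e1 : (A.inv ^ (1 + t)) y = A.inv ((A.inv ^ t) y) := by
    rw [A.inv_rpow_add zero_le_one ht0, CFC.rpow_one A.inv A.inv_nonneg]
    rfl
  have m1 : (A.inv ^ (1 + t)) y ∈ A.op.domain := by rw [e1]; exact A.inv_mem _
  have m2 : (A.inv ^ (1 + t)) y ∈ (A.fracPow θ).domain := by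
    rcases lt_or_ge 0 θ with h0 | h0
    · have : t = θ := max_eq_left h0.le
      rw [add_comm, A.inv_rpow_add ht0 zero_le_one, this]
      exact (A.fracPow_rpow h0 _).1
    · rw [fracPow, if_neg (not_lt.mpr h0)]
      exact Submodule.mem_top
  rw [← ContinuousLinearMap.adjoint_inner_left, ← ContinuousLinearMap.adjoint_inner_left,
    hs.adjoint_eq, ← H₁ _ m1 m2, ← H₂ _ m1 m2]

variable (A)

/-- The operator `(u, v) ↦ (v, -(A u + A ^ θ v))` on the phase space `H¹ × H`, with domain the
pairs `(u, v)` such that `v ∈ H¹` and `A u + A ^ θ v ∈ H`. -/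
def generator (θ : ℝ) : A.PhaseSpace →ₗ.[ℂ] A.PhaseSpace where
  domain :=
    { carrier := {z | (∃ v₁ : A.EnergySpace, A.incl v₁ = z.snd) ∧
        ∃ h : H, A.WeakSum θ (A.incl z.fst) z.snd h}
      zero_mem' := ⟨⟨0, by simp⟩, 0, fun w h₁ h₂ => by simp⟩
      add_mem' := by
        rintro z z' ⟨⟨v, hv⟩, h, hh⟩ ⟨⟨v', hv'⟩, h', hh'⟩
        refine ⟨⟨v + v', by simp [hv, hv']⟩, h + h', ?_⟩
        simpa using hh.add hh'
      smul_mem' := by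
        rintro c z ⟨⟨v, hv⟩, h, hh⟩
        refine ⟨⟨c • v, by simp [hv]⟩, c • h, ?_⟩
        simpa using hh.smul c }
  toFun :=
    { toFun := fun z => WithLp.toLp 2 (z.2.1.choose, -z.2.2.choose)
      map_add' := by
        intro z z'
        have e1 : (z + z').2.1.choose = z.2.1.choose + z'.2.1.choose := by
          apply A.incl_injective
          rw [map_add, (z + z').2.1.choose_spec, z.2.1.choose_spec, z'.2.1.choose_spec]
          simp
        have e2 : (z + z').2.2.choose = z.2.2.choose + z'.2.2.choose := by
          refine (z + z').2.2.choose_spec.unique ?_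
          simpa using z.2.2.choose_spec.add z'.2.2.choose_spec
        rw [e1, e2, neg_add, ← WithLp.toLp_add, Prod.mk_add_mk]
      map_smul' := by
        intro c z
        have e1 : (c • z).2.1.choose = c • z.2.1.choose := by
          apply A.incl_injective
          rw [map_smul, (c • z).2.1.choose_spec, z.2.1.choose_spec]
          simp
        have e2 : (c • z).2.2.choose = c • z.2.2.choose := by
          refine (c • z).2.2.choose_spec.unique ?_
          simpa using z.2.2.choose_spec.smul c
        rw [e1, e2, ← smul_neg, RingHom.id_apply, ← WithLp.toLp_smul, Prod.smul_mk] }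

theorem generator_fst (θ : ℝ) (z : (A.generator θ).domain) :
    A.incl (A.generator θ z).fst = (z : A.PhaseSpace).snd :=
  z.2.1.choose_spec

theorem generator_snd (θ : ℝ) (z : (A.generator θ).domain) :
    A.WeakSum θ (A.incl (z : A.PhaseSpace).fst) (z : A.PhaseSpace).snd
      (-(A.generator θ z).snd) := by
  have h : -(A.generator θ z).snd = z.2.2.choose := neg_neg _
  rw [h]
  exact z.2.2.choose_spec

end StrictlyPositiveOperator

/-- The number `ξ_s⁺`. -/
def xiPlus (θ s : ℝ) : ℂ :=
  if 2 ≤ s ^ (θ - 1 / 2) then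
    ((-(s ^ θ / 2) + √(s ^ (2 * θ) - 4 * s) / 2 : ℝ) : ℂ)
  else
    ((-(s ^ θ / 2) : ℝ) : ℂ) + Complex.I * ((√(4 * s - s ^ (2 * θ)) / 2 : ℝ) : ℂ)

/-- The number `ξ_s⁻`. -/
def xiMinus (θ s : ℝ) : ℂ :=
  if 2 ≤ s ^ (θ - 1 / 2) then
    ((-(s ^ θ / 2) - √(s ^ (2 * θ) - 4 * s) / 2 : ℝ) : ℂ)
  else
    ((-(s ^ θ / 2) : ℝ) : ℂ) - Complex.I * ((√(4 * s - s ^ (2 * θ)) / 2 : ℝ) : ℂ)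

end DampedWave

end

/-!
Put `B = A⁻¹`, a bounded positive injective operator, and `a = max θ 1`. The common domain of `A`
and `A ^ θ` is the range of `B ^ a`, so the weak equation `A u + A ^ θ v = h` is the equation
`B ^ (a - 1) u + B ^ (a - θ) v = B ^ a h` between bounded operators. In the coordinates
`(p, v) = (A ^ (1/2) u, v)`, eliminating `v` from the resolvent equation of the generator leaves
`P(ξ) p = Q(ξ) (f, g)`, where `P(ξ) = B ^ (a - 1) + ξ B ^ (a - θ) + ξ² B ^ a`, and `ξ` lies in the
resolvent set exactly when `P(ξ)` is invertible. By the functional calculus this means that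
`x ^ (a - 1) + ξ x ^ (a - θ) + ξ² x ^ a` has no zero on the spectrum of `B`. At `x = 1 / s > 0` this
function is `x ^ a (s + ξ s ^ θ + ξ²)`, with roots `ξ_s^±`; the point `x = 0`, which belongs to the
spectrum of `B` exactly when `A` is unbounded, contributes `ξ = -1` if `θ = 1`, `ξ = 0` if `θ > 1`,
and nothing if `θ < 1`.
-/

noncomputable section

namespace DampedWave

/-! ### Resolvents in terms of graphs -/

theorem bijective_iff_existsUnique_mem_graph {R E F : Type*} [Ring R] [AddCommGroup E] [Module R E]
    [AddCommGroup F] [Module R F] (T : E →ₗ.[R] F) :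
    Function.Bijective (fun x : T.domain => T x) ↔ ∀ y, ∃! x, (x, y) ∈ T.graph := by
  rw [Function.bijective_iff_existsUnique]
  refine forall_congr' fun y => ⟨?_, ?_⟩
  · rintro ⟨x, rfl, hx⟩
    refine ⟨x, T.mem_graph x, fun x' hx' => ?_⟩
    obtain ⟨z, rfl, hz⟩ := T.mem_graph_iff.mp hx'
    exact congrArg Subtype.val (hx z hz)
  · rintro ⟨x, hx, hunique⟩
    obtain ⟨z, rfl, rfl⟩ := T.mem_graph_iff.mp hx
    exact ⟨z, rfl, fun z' hz' => Subtype.ext (hunique z' (hz' ▸ T.mem_graph z'))⟩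

section Resolvent

variable {E : Type*} [NormedAddCommGroup E] [NormedSpace ℂ E] {T : E →ₗ.[ℂ] E} {ξ : ℂ}

theorem smul_sub_mem_graph_iff {x y : E} :
    (x, ξ • x - y) ∈ T.graph ↔ ∃ h : x ∈ T.domain, ξ • x - T ⟨x, h⟩ = y := by
  rw [LinearPMap.mem_graph_iff]
  constructor
  · rintro ⟨x, rfl, h⟩
    exact ⟨x.2, by rw [Subtype.coe_eta, h, sub_sub_cancel]⟩
  · rintro ⟨h, rfl⟩
    exact ⟨⟨x, h⟩, rfl, (sub_sub_cancel _ _).symm⟩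

theorem mem_resolventSet_iff_graph :
    ξ ∈ resolventSet T ↔ ∃ R : E →L[ℂ] E, ∀ x y, (x, ξ • x - y) ∈ T.graph ↔ x = R y := by
  simp only [smul_sub_mem_graph_iff]
  refine exists_congr fun R => ⟨fun ⟨hright, hleft⟩ x y => ⟨?_, ?_⟩, fun h => ⟨fun y => ?_, ?_⟩⟩
  · rintro ⟨hx, rfl⟩
    exact (hleft ⟨x, hx⟩).symm
  · rintro rfl
    exact hright y
  · exact (h _ y).mpr rfl
  · exact fun x => ((h x _).mp ⟨x.2, rfl⟩).symm

theorem existsUnique_mem_graph_of_mem_resolventSet (h : ξ ∈ resolventSet T) (y : E) :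
    ∃! x, (x, ξ • x - y) ∈ T.graph := by
  obtain ⟨R, hR⟩ := mem_resolventSet_iff_graph.mp h
  simp only [hR, existsUnique_eq]

/-- `R` is an everywhere defined bounded two-sided inverse of the unbounded operator `T`. -/
def IsBoundedInverse (T : E →ₗ.[ℂ] E) (R : E →L[ℂ] E) : Prop :=
  ∀ x y, (x, y) ∈ T.graph ↔ R y = x

namespace IsBoundedInverse

variable {R : E →L[ℂ] E}

theorem zero_mem_resolventSet (h : IsBoundedInverse T R) : (0 : ℂ) ∈ resolventSet T :=
  mem_resolventSet_iff_graph.mpr ⟨-R, fun x y => by simp [h x, eq_comm]⟩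

theorem smul_sub_mem_graph_iff (h : IsBoundedInverse T R) (hξ : ξ ≠ 0) {x y : E} :
    (x, ξ • x - y) ∈ T.graph ↔ (algebraMap ℂ (E →L[ℂ] E) ξ⁻¹ - R) x = -(ξ⁻¹ • R y) := by
  have hscaled : (algebraMap ℂ (E →L[ℂ] E) ξ⁻¹ - R) x + ξ⁻¹ • R y =
      -(ξ⁻¹ • (R (ξ • x - y) - x)) := by
    simp only [sub_apply, ContinuousLinearMap.algebraMap_apply, map_sub, map_smul, smul_sub,
      inv_smul_smul₀ hξ]
    abel
  rw [h, ← sub_eq_zero, eq_neg_iff_add_eq_zero, hscaled, neg_eq_zero,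
    smul_eq_zero_iff_right (inv_ne_zero hξ)]

theorem mem_resolventSet_iff (h : IsBoundedInverse T R) (hξ : ξ ≠ 0) :
    ξ ∈ resolventSet T ↔ IsUnit (algebraMap ℂ (E →L[ℂ] E) ξ⁻¹ - R) := by
  rw [mem_resolventSet_iff_graph]
  simp only [h.smul_sub_mem_graph_iff hξ]
  set D := algebraMap ℂ (E →L[ℂ] E) ξ⁻¹ - R with hD
  constructor
  · rintro ⟨S, hS⟩
    have hDS (y : E) : D (S y) = -(ξ⁻¹ • R y) := (hS _ y).mpr rfl
    have hSD (y : E) : S (D y) = -(ξ⁻¹ • R y) := by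
      refine ((hS _ _).mp ?_).symm
      simp only [hD, sub_apply, ContinuousLinearMap.algebraMap_apply, map_sub, map_smul, map_neg]
    have hDR (y : E) : ξ • D y + ξ • R y = y := by
      rw [← smul_add, hD, sub_apply, sub_add_cancel, ContinuousLinearMap.algebraMap_apply,
        smul_inv_smul₀ hξ]
    -- `D = -ξ⁻¹ (ξ - T) R`, hence `D⁻¹ = -ξ T S = ξ - ξ² S`.
    refine isUnit_iff_exists.mpr ⟨ξ • 1 - ξ ^ 2 • S, ?_, ?_⟩ <;> ext y <;>
      refine Eq.trans ?_ (hDR y)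
    · simp [hDS, pow_two, mul_smul, smul_inv_smul₀ hξ]
    · simp [hSD, pow_two, mul_smul, smul_inv_smul₀ hξ]
  · rintro ⟨U, hU⟩
    refine ⟨-(ξ⁻¹ • ((↑U⁻¹ : E →L[ℂ] E) ∘L R)), fun x y => ?_⟩
    rw [← hU]
    refine (ContinuousLinearEquiv.ofUnit U).eq_symm_apply.symm.trans ?_
    change x = (↑U⁻¹ : E →L[ℂ] E) (-(ξ⁻¹ • R y)) ↔ _
    simp

theorem isUnit_iff (h : IsBoundedInverse T R) : IsUnit R ↔ IsBoundedOperator T := by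
  constructor
  · rintro ⟨U, rfl⟩
    have hT (x : E) : (x, (↑U⁻¹ : E →L[ℂ] E) x) ∈ T.graph :=
      (h _ _).mpr (DFunLike.congr_fun U.mul_inv x)
    refine ⟨Submodule.eq_top_iff'.mpr fun x => T.mem_domain_of_mem_graph (hT x),
      ‖(↑U⁻¹ : E →L[ℂ] E)‖, fun x => ?_⟩
    rw [T.mem_graph_snd_inj (T.mem_graph x) (hT x) rfl]
    exact ContinuousLinearMap.le_opNorm _ _
  · rintro ⟨hdom, hbound⟩
    let S : E →L[ℂ] E := LinearMap.mkContinuousOfExistsBound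
      (T.toFun ∘ₗ (LinearEquiv.ofTop T.domain hdom).symm.toLinearMap)
      (hbound.imp fun C hC x => hC _)
    have hS (x : E) : (x, S x) ∈ T.graph := T.mem_graph ((LinearEquiv.ofTop T.domain hdom).symm x)
    have hRS (x : E) : R (S x) = x := (h _ _).mp (hS x)
    have hSR (y : E) : S (R y) = y := T.mem_graph_snd_inj (hS (R y)) ((h _ _).mpr rfl) rfl
    exact isUnit_iff_exists.mpr ⟨S, ContinuousLinearMap.ext hRS, ContinuousLinearMap.ext hSR⟩

end IsBoundedInverse

end Resolvent

theorem isUnit_sum_smul_cfc_iff {𝓐 ι : Type*} [CStarAlgebra 𝓐] [Fintype ι] {b : 𝓐}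
    (hb : IsSelfAdjoint b) (c : ι → ℂ) {f : ι → ℝ → ℝ}
    (hf : ∀ i, ContinuousOn (f i) (_root_.spectrum ℝ b)) :
    IsUnit (∑ i, c i • cfc (f i) b) ↔
      ∀ x ∈ _root_.spectrum ℝ b, ∑ i, c i * (f i x : ℂ) ≠ 0 := by
  have hre : Set.MapsTo Complex.re (_root_.spectrum ℂ b) (_root_.spectrum ℝ b) :=
    Set.mapsTo_iff_image_subset.mpr hb.spectrumRestricts.image.subset
  have hcont (i : ι) : ContinuousOn (fun z : ℂ => (f i z.re : ℂ)) (_root_.spectrum ℂ b) :=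
    Complex.continuous_ofReal.comp_continuousOn
      ((hf i).comp Complex.continuous_re.continuousOn hre)
  have hterm (i : ι) : ContinuousOn (fun z : ℂ => c i * (f i z.re : ℂ)) (_root_.spectrum ℂ b) :=
    continuousOn_const.mul (hcont i)
  have hcfc : ∑ i, c i • cfc (f i) b = cfc (∑ i, fun z : ℂ => c i * (f i z.re : ℂ)) b := by
    rw [cfc_sum_univ _ b hterm]
    refine Finset.sum_congr rfl fun i _ => ?_
    rw [cfc_const_mul (c i) _ b (hcont i), cfc_real_eq_complex (f i) hb]
  have hsum : ContinuousOn (∑ i, fun z : ℂ => c i * (f i z.re : ℂ)) (_root_.spectrum ℂ b) := by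
    simpa only [Finset.sum_fn] using continuousOn_finsetSum Finset.univ fun i _ => hterm i
  rw [hcfc, isUnit_cfc_iff _ b hsum hb.isStarNormal,
    ← hb.spectrumRestricts.algebraMap_image, Set.forall_mem_image]
  simp

/-! ### The characteristic roots -/

theorem two_le_rpow_sub_half_iff {θ s : ℝ} (hs : 0 < s) :
    2 ≤ s ^ (θ - 1 / 2) ↔ 4 * s ≤ s ^ (2 * θ) := by
  have hsq : s ^ (2 * θ) = (s ^ (θ - 1 / 2)) ^ 2 * s := by
    rw [← Real.rpow_natCast, ← Real.rpow_mul hs.le, ← Real.rpow_add_one hs.ne']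
    congr 1
    push_cast
    ring
  rw [hsq, mul_le_mul_iff_left₀ hs, ← sq_le_sq₀ zero_le_two (Real.rpow_nonneg hs.le _)]
  norm_num

theorem exists_sq_eq_discrim_and_xi_eq {θ s : ℝ} (hs : 0 < s) :
    ∃ r : ℂ, discrim 1 ((s ^ θ : ℝ) : ℂ) s = r * r ∧
      xiPlus θ s = (-(s ^ θ : ℝ) + r) / (2 * 1) ∧ xiMinus θ s = (-(s ^ θ : ℝ) - r) / (2 * 1) := by
  have hsq : s ^ (2 * θ) = (s ^ θ) ^ 2 := by
    rw [mul_comm, Real.rpow_mul hs.le, Real.rpow_two]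
  simp only [xiPlus, xiMinus, discrim, two_le_rpow_sub_half_iff hs, hsq]
  split_ifs with h
  · refine ⟨(√((s ^ θ) ^ 2 - 4 * s) : ℝ), ?_, by push_cast; ring, by push_cast; ring⟩
    rw [← Complex.ofReal_mul, Real.mul_self_sqrt (sub_nonneg.mpr h)]
    push_cast
    ring
  · refine ⟨Complex.I * (√(4 * s - (s ^ θ) ^ 2) : ℝ), ?_, by push_cast; ring, by push_cast; ring⟩
    rw [mul_mul_mul_comm, Complex.I_mul_I, ← Complex.ofReal_mul,
      Real.mul_self_sqrt (sub_nonneg.mpr (not_le.mp h).le)]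
    push_cast
    ring

theorem eq_xiPlus_or_eq_xiMinus_iff {θ s : ℝ} (hs : 0 < s) {ξ : ℂ} :
    ξ = xiPlus θ s ∨ ξ = xiMinus θ s ↔ (s : ℂ) + ξ * (s ^ θ : ℝ) + ξ ^ 2 = 0 := by
  obtain ⟨r, hr, hplus, hminus⟩ := exists_sq_eq_discrim_and_xi_eq (θ := θ) hs
  rw [hplus, hminus, ← quadratic_eq_zero_iff one_ne_zero hr]
  exact Eq.congr_left (by ring)

theorem ne_zero_of_eq_xiPlus_or_eq_xiMinus {θ s : ℝ} (hs : 0 < s) {ξ : ℂ}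
    (h : ξ = xiPlus θ s ∨ ξ = xiMinus θ s) : ξ ≠ 0 := by
  rintro rfl
  simpa [hs.ne'] using (eq_xiPlus_or_eq_xiMinus_iff hs).mp h

/-- The symbol `x ^ a (x⁻¹ + ξ x ^ (-θ) + ξ²)`, `a = max θ 1`, of the quadratic pencil of the
generator as a function of `A⁻¹`. The factor `x ^ a` makes all exponents nonnegative, so that the
symbol is continuous up to `x = 0`. -/
def pencilSymbol (θ : ℝ) (ξ : ℂ) (x : ℝ) : ℂ :=
  (x ^ (max θ 1 - 1) : ℝ) + ξ * (x ^ (max θ 1 - θ) : ℝ) + ξ ^ 2 * (x ^ max θ 1 : ℝ)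

theorem pencilSymbol_eq_zero_iff_of_pos {θ x : ℝ} (hx : 0 < x) {ξ : ℂ} :
    pencilSymbol θ ξ x = 0 ↔ ξ = xiPlus θ x⁻¹ ∨ ξ = xiMinus θ x⁻¹ := by
  have hpow : ((x ^ max θ 1 : ℝ) : ℂ) ≠ 0 :=
    Complex.ofReal_ne_zero.mpr (Real.rpow_pos_of_pos hx _).ne'
  have hfactor : pencilSymbol θ ξ x =
      (x ^ max θ 1 : ℝ) * ((x⁻¹ : ℝ) + ξ * (x⁻¹ ^ θ : ℝ) + ξ ^ 2) := by
    rw [pencilSymbol, Real.rpow_sub hx, Real.rpow_sub hx, Real.rpow_one, Real.inv_rpow hx.le]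
    push_cast
    ring
  rw [eq_xiPlus_or_eq_xiMinus_iff (inv_pos.mpr hx), hfactor, mul_eq_zero_iff_left hpow]

theorem pencilSymbol_zero_eq_zero_iff {θ : ℝ} {ξ : ℂ} :
    pencilSymbol θ ξ 0 = 0 ↔ θ = 1 ∧ ξ = -1 ∨ 1 < θ ∧ ξ = 0 := by
  rcases lt_trichotomy θ 1 with h | rfl | h
  · simp [pencilSymbol, Real.zero_rpow (sub_pos.mpr h).ne', h.ne, h.le]
  · simp [pencilSymbol, add_comm, add_eq_zero_iff_eq_neg]
  · simp [pencilSymbol, max_eq_left h.le, Real.zero_rpow (sub_pos.mpr h).ne', h, h.ne',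
      Real.zero_rpow (zero_lt_one.trans h).ne']

namespace StrictlyPositiveOperator

variable {H : Type*} [NormedAddCommGroup H] [InnerProductSpace ℂ H] [CompleteSpace H]
  (A : StrictlyPositiveOperator H) {θ : ℝ} {ξ : ℂ}

/-! ### Powers of the bounded inverse -/

theorem inv_rpow_apply_inv_rpow {s t : ℝ} (hs : 0 ≤ s) (ht : 0 ≤ t) (x : H) :
    (A.inv ^ s) ((A.inv ^ t) x) = (A.inv ^ (s + t)) x := by
  rw [A.inv_rpow_add hs ht, mul_apply_eq_comp]

theorem inner_inv_rpow_left (t : ℝ) (x y : H) :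
    inner ℂ ((A.inv ^ t) x) y = inner ℂ x ((A.inv ^ t) y) := by
  have hself : IsSelfAdjoint (A.inv ^ t) := .of_nonneg CFC.rpow_nonneg
  rw [← ContinuousLinearMap.adjoint_inner_right, hself.adjoint_eq]

theorem isBoundedInverse_inv : IsBoundedInverse A.op A.inv := fun x y => by
  rw [← A.fracPow_one, A.fracPow_mem_graph_iff one_pos, CFC.rpow_one A.inv A.inv_nonneg]

theorem inv_rpow_mem_graph_fracPow {t : ℝ} (ht : 0 ≤ t) (hθ : θ ≤ t) (y : H) :
    ((A.inv ^ t) y, (A.inv ^ (t - θ)) y) ∈ (A.fracPow θ).graph := by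
  rcases lt_or_ge 0 θ with hpos | hnonpos
  · rw [A.fracPow_mem_graph_iff hpos, A.inv_rpow_apply_inv_rpow hpos.le (sub_nonneg.mpr hθ),
      add_sub_cancel]
  · rw [fracPow, if_neg hnonpos.not_gt, sub_eq_neg_add,
      ← A.inv_rpow_apply_inv_rpow (neg_nonneg.mpr hnonpos) ht]
    simp [LinearPMap.mem_graph_iff]

theorem mem_graph_op_and_mem_graph_fracPow_iff {w w₁ w₂ : H} :
    (w, w₁) ∈ A.op.graph ∧ (w, w₂) ∈ (A.fracPow θ).graph ↔
      ∃ y, (A.inv ^ max θ 1) y = w ∧ (A.inv ^ (max θ 1 - 1)) y = w₁ ∧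
        (A.inv ^ (max θ 1 - θ)) y = w₂ := by
  have hop (y : H) : ((A.inv ^ max θ 1) y, (A.inv ^ (max θ 1 - 1)) y) ∈ A.op.graph :=
    A.fracPow_one ▸ A.inv_rpow_mem_graph_fracPow (by positivity) (le_max_right θ 1) y
  have hpow (y : H) := A.inv_rpow_mem_graph_fracPow (by positivity) (le_max_left θ 1) y
  constructor
  · rintro ⟨h₁, h₂⟩
    obtain ⟨y, rfl⟩ : ∃ y, (A.inv ^ max θ 1) y = w := by
      rcases le_total θ 1 with h | h
      · rw [← A.fracPow_one, A.fracPow_mem_graph_iff one_pos] at h₁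
        exact ⟨w₁, by rwa [max_eq_right h]⟩
      · rw [A.fracPow_mem_graph_iff (zero_lt_one.trans_le h)] at h₂
        exact ⟨w₂, by rwa [max_eq_left h]⟩
    exact ⟨y, rfl, A.op.mem_graph_snd_inj (hop y) h₁ rfl,
      (A.fracPow θ).mem_graph_snd_inj (hpow y) h₂ rfl⟩
  · rintro ⟨y, rfl, rfl, rfl⟩
    exact ⟨hop y, hpow y⟩

theorem weakSum_iff_forall_mem_graph {u v h : H} :
    A.WeakSum θ u v h ↔ ∀ w w₁ w₂, (w, w₁) ∈ A.op.graph ∧ (w, w₂) ∈ (A.fracPow θ).graph →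
      inner ℂ w₁ u + inner ℂ w₂ v = inner ℂ w h := by
  constructor
  · rintro hsum w w₁ w₂ ⟨h₁, h₂⟩
    obtain ⟨⟨_, hw₁⟩, rfl, rfl⟩ := A.op.mem_graph_iff.mp h₁
    obtain ⟨⟨_, hw₂⟩, rfl, rfl⟩ := (A.fracPow θ).mem_graph_iff.mp h₂
    exact hsum _ hw₁ hw₂
  · exact fun hsum w h₁ h₂ => hsum w _ _ ⟨A.op.mem_graph ⟨w, h₁⟩, (A.fracPow θ).mem_graph ⟨w, h₂⟩⟩

theorem weakSum_iff {u v h : H} : A.WeakSum θ u v h ↔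
    (A.inv ^ (max θ 1 - 1)) u + (A.inv ^ (max θ 1 - θ)) v = (A.inv ^ max θ 1) h := by
  rw [A.weakSum_iff_forall_mem_graph]
  constructor
  · refine fun hsum => ext_inner_left ℂ fun y => ?_
    have hy := hsum _ _ _ (A.mem_graph_op_and_mem_graph_fracPow_iff.mpr ⟨y, rfl, rfl, rfl⟩)
    simpa only [inner_add_right, A.inner_inv_rpow_left] using hy
  · rintro heq w w₁ w₂ hw
    obtain ⟨y, rfl, rfl, rfl⟩ := A.mem_graph_op_and_mem_graph_fracPow_iff.mp hw
    simp only [A.inner_inv_rpow_left, ← inner_add_right, heq]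

/-! ### The phase space in coordinates -/

theorem sqrtOp_bijective : Function.Bijective A.sqrtOp :=
  ⟨(injective_iff_map_eq_zero A.sqrtOp).mpr fun _ => A.sqrtOp_eq_zero, fun y =>
    let ⟨hmem, hy⟩ := A.fracPow_rpow one_half_pos y
    ⟨⟨_, hmem⟩, hy⟩⟩

theorem norm_sqrtOp (u : A.EnergySpace) : ‖A.sqrtOp u‖ = ‖u‖ := by
  rw [@norm_eq_sqrt_re_inner ℂ, @norm_eq_sqrt_re_inner ℂ A.EnergySpace]
  rfl

/-- The unitary operator `A ^ (1/2) : H¹ → H`. -/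
def sqrtEquiv : A.EnergySpace ≃ₗᵢ[ℂ] H where
  toLinearEquiv := .ofBijective A.sqrtOp A.sqrtOp_bijective
  norm_map' := A.norm_sqrtOp

/-- The coordinates `(u, v) ↦ (A ^ (1/2) u, v)`, in which the generator is expressed by bounded
powers of `A⁻¹`. -/
def phaseEquiv : A.PhaseSpace ≃L[ℂ] H × H :=
  (WithLp.prodContinuousLinearEquiv 2 ℂ A.EnergySpace H).trans
    (A.sqrtEquiv.toContinuousLinearEquiv.prodCongr (.refl ℂ H))

theorem incl_fst_eq_inv_rpow (z : A.PhaseSpace) :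
    A.incl z.fst = (A.inv ^ (1 / 2 : ℝ)) (A.phaseEquiv z).1 :=
  (A.rpow_fracPow one_half_pos z.fst).symm

theorem mem_graph_generator_iff_weakSum {z z' : A.PhaseSpace} :
    (z, z') ∈ (A.generator θ).graph ↔
      A.incl z'.fst = z.snd ∧ A.WeakSum θ (A.incl z.fst) z.snd (-z'.snd) := by
  rw [LinearPMap.mem_graph_iff]
  constructor
  · rintro ⟨z, rfl, rfl⟩
    exact ⟨A.generator_fst θ z, A.generator_snd θ z⟩
  · rintro ⟨hfst, hsnd⟩
    let x : (A.generator θ).domain := ⟨z, ⟨z'.fst, hfst⟩, -z'.snd, hsnd⟩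
    refine ⟨x, rfl, (WithLp.ofLp_injective 2) (Prod.ext ?_ ?_)⟩
    · exact A.incl_injective ((A.generator_fst θ x).trans hfst.symm)
    · exact neg_injective ((A.generator_snd θ x).unique hsnd)

theorem mem_graph_generator_iff {z z' : A.PhaseSpace} :
    (z, z') ∈ (A.generator θ).graph ↔
      (A.phaseEquiv z).2 = (A.inv ^ (1 / 2 : ℝ)) (A.phaseEquiv z').1 ∧
      (A.inv ^ (max θ 1 - 1)) (A.phaseEquiv z).1 + (A.inv ^ (max θ 1 - θ)) (A.phaseEquiv z').1 +
        (A.inv ^ (max θ 1 - 1 / 2)) (A.phaseEquiv z').2 = 0 := by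
  rw [A.mem_graph_generator_iff_weakSum, eq_comm, A.incl_fst_eq_inv_rpow, A.incl_fst_eq_inv_rpow]
  refine and_congr_right fun hv => ?_
  have hinj := A.inv_rpow_injective (one_half_pos (α := ℝ)).le
  have ha : 1 ≤ max θ 1 := le_max_right θ 1
  have hpow (t : ℝ) (ht : 0 ≤ t) (x : H) :
      (A.inv ^ t) ((A.inv ^ (1 / 2 : ℝ)) x) = (A.inv ^ (1 / 2 : ℝ)) ((A.inv ^ t) x) := by
    rw [A.inv_rpow_apply_inv_rpow ht one_half_pos.le, A.inv_rpow_apply_inv_rpow one_half_pos.le ht,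
      add_comm]
  have hsplit : A.inv ^ max θ 1 = A.inv ^ (1 / 2 : ℝ) * A.inv ^ (max θ 1 - 1 / 2) := by
    rw [← A.inv_rpow_add one_half_pos.le (by linarith), add_sub_cancel]
  rw [hv, A.weakSum_iff, hpow _ (sub_nonneg.mpr ha), hpow _ (sub_nonneg.mpr (le_max_left θ 1)),
    hsplit, mul_apply_eq_comp, ← map_add, hinj.eq_iff, map_neg, eq_neg_iff_add_eq_zero]
  rfl

/-- The quadratic pencil `A ^ (-a) (A + ξ A ^ θ + ξ²)`, `a = max θ 1`, written with bounded powers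
of `A⁻¹`. Its invertibility characterizes the resolvent set of the generator. -/
def pencil (θ : ℝ) (ξ : ℂ) : H →L[ℂ] H :=
  A.inv ^ (max θ 1 - 1) + ξ • A.inv ^ (max θ 1 - θ) + ξ ^ 2 • A.inv ^ max θ 1

/-- The right-hand side of the pencil equation obtained from the resolvent equation of the
generator, as a function of the data of the latter in the coordinates `phaseEquiv`. -/
def pencilSource (θ : ℝ) (ξ : ℂ) : H × H →L[ℂ] H :=
  (A.inv ^ (max θ 1 - θ) + ξ • A.inv ^ max θ 1).coprod (A.inv ^ (max θ 1 - 1 / 2))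

theorem smul_sub_mem_graph_generator_iff {y z : A.PhaseSpace} :
    (z, ξ • z - y) ∈ (A.generator θ).graph ↔
      (A.phaseEquiv z).2 =
          (A.inv ^ (1 / 2 : ℝ)) (ξ • (A.phaseEquiv z).1 - (A.phaseEquiv y).1) ∧
        A.pencil θ ξ (A.phaseEquiv z).1 = A.pencilSource θ ξ (A.phaseEquiv y) := by
  rw [A.mem_graph_generator_iff, map_sub, map_smul]
  obtain ⟨p, v⟩ := A.phaseEquiv z
  obtain ⟨f, g⟩ := A.phaseEquiv y
  refine and_congr_right fun hv => ?_
  have hv' : (A.inv ^ (max θ 1 - 1 / 2)) v = (A.inv ^ max θ 1) (ξ • p - f) := by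
    simp only [Prod.fst_sub, Prod.smul_fst] at hv
    rw [hv, A.inv_rpow_apply_inv_rpow (by linarith [le_max_right θ 1]) one_half_pos.le,
      sub_add_cancel]
  rw [← sub_eq_zero (a := A.pencil θ ξ p)]
  refine Eq.congr_left ?_
  simp only [pencil, pencilSource, ContinuousLinearMap.coprod_apply, add_apply, smul_apply, map_sub,
    map_smul, Prod.fst_sub, Prod.snd_sub, Prod.smul_fst, Prod.smul_snd, hv']
  module

theorem pencil_apply_of_le_one (hθ : θ ≤ 1) (x : H) :
    A.pencil θ ξ x = x + ξ • A.pencilSource θ ξ (x, 0) := by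
  simp only [pencil, pencilSource, max_eq_right hθ, sub_self, CFC.rpow_zero A.inv A.inv_nonneg,
    ContinuousLinearMap.coprod_apply, add_apply, smul_apply, map_zero, one_apply_eq_self]
  module

theorem pencilSource_apply_of_one_le (hθ : 1 ≤ θ) (x : H) :
    A.pencilSource θ ξ (x, -(ξ • (A.inv ^ (1 / 2 : ℝ)) x)) = x := by
  simp only [pencilSource, max_eq_left hθ, sub_self, CFC.rpow_zero A.inv A.inv_nonneg,
    ContinuousLinearMap.coprod_apply, add_apply, smul_apply, map_neg, map_smul, one_apply_eq_self]
  rw [A.inv_rpow_apply_inv_rpow (by linarith) one_half_pos.le, sub_add_cancel, add_neg_cancel_right]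

theorem surjective_pencil_of_forall_exists (h : ∀ y, ∃ p, A.pencil θ ξ p = A.pencilSource θ ξ y) :
    Function.Surjective (A.pencil θ ξ) := fun x => by
  rcases le_total θ 1 with hθ | hθ
  · obtain ⟨p, hp⟩ := h (x, 0)
    refine ⟨x - ξ • p, ?_⟩
    rw [map_sub, map_smul, hp, A.pencil_apply_of_le_one hθ, add_sub_cancel_right]
  · simpa only [A.pencilSource_apply_of_one_le hθ] using
      h (x, -(ξ • (A.inv ^ (1 / 2 : ℝ)) x))

theorem isUnit_pencil_of_existsUnique
    (h : ∀ y, ∃! z, (z, ξ • z - y) ∈ (A.generator θ).graph) : IsUnit (A.pencil θ ξ) := by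
  simp only [A.smul_sub_mem_graph_generator_iff] at h
  refine ContinuousLinearMap.isUnit_iff_bijective.mpr
    ⟨(injective_iff_map_eq_zero _).mpr fun p hp => ?_,
      A.surjective_pencil_of_forall_exists fun y => ?_⟩
  · let z := A.phaseEquiv.symm (p, (A.inv ^ (1 / 2 : ℝ)) (ξ • p))
    have hz : A.phaseEquiv z = (p, (A.inv ^ (1 / 2 : ℝ)) (ξ • p)) :=
      A.phaseEquiv.apply_symm_apply _
    have hzero : z = 0 := (h 0).unique (by simp [hz, hp]) (by simp)
    simpa [hzero] using (congrArg Prod.fst hz).symm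
  · obtain ⟨z, ⟨-, hz⟩, -⟩ := h (A.phaseEquiv.symm y)
    exact ⟨_, hz.trans (congrArg _ (A.phaseEquiv.apply_symm_apply y))⟩

theorem mem_resolventSet_generator_of_isUnit_pencil (h : IsUnit (A.pencil θ ξ)) :
    ξ ∈ resolventSet (A.generator θ) := by
  obtain ⟨U, hU⟩ := h
  let S : H × H →L[ℂ] H := (↑U⁻¹ : H →L[ℂ] H) ∘L A.pencilSource θ ξ
  let R : H × H →L[ℂ] H × H :=
    S.prod ((A.inv ^ (1 / 2 : ℝ)) ∘L (ξ • S - ContinuousLinearMap.fst ℂ H H))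
  have hsolve (p : H) (y : H × H) : A.pencil θ ξ p = A.pencilSource θ ξ y ↔ p = S y := by
    rw [← hU]
    exact (ContinuousLinearEquiv.ofUnit U).eq_symm_apply.symm
  refine mem_resolventSet_iff_graph.mpr
    ⟨A.phaseEquiv.symm ∘L R ∘L A.phaseEquiv, fun z y => ?_⟩
  rw [A.smul_sub_mem_graph_generator_iff, hsolve]
  refine Iff.trans ?_ A.phaseEquiv.eq_symm_apply.symm
  rw [Prod.ext_iff, and_comm]
  refine and_congr_right fun hp => ?_
  rw [hp]
  rfl

theorem resolventSet_generator_tfae : List.TFAE [ξ ∈ resolventSet (A.generator θ),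
    ∀ y, ∃! z, (z, ξ • z - y) ∈ (A.generator θ).graph, IsUnit (A.pencil θ ξ)] := by
  tfae_have 1 → 2 := existsUnique_mem_graph_of_mem_resolventSet
  tfae_have 2 → 3 := A.isUnit_pencil_of_existsUnique
  tfae_have 3 → 1 := A.mem_resolventSet_generator_of_isUnit_pencil
  tfae_finish

/-! ### The spectrum of the generator -/

theorem isUnit_pencil_iff :
    IsUnit (A.pencil θ ξ) ↔ ∀ x ∈ _root_.spectrum ℝ A.inv, pencilSymbol θ ξ x ≠ 0 := by
  have hpow (t : ℝ) : A.inv ^ t = cfc (fun x : ℝ => x ^ t) A.inv :=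
    CFC.rpow_eq_cfc_real A.inv_nonneg
  have hexp : ∀ i, 0 ≤ ![max θ 1 - 1, max θ 1 - θ, max θ 1] i := by
    simp [Fin.forall_fin_succ]
  have hiff := isUnit_sum_smul_cfc_iff (IsSelfAdjoint.of_nonneg A.inv_nonneg) ![1, ξ, ξ ^ 2]
    fun i => (Real.continuous_rpow_const (hexp i)).continuousOn
  simpa [Fin.sum_univ_three, ← hpow, pencil, pencilSymbol] using hiff

theorem zero_mem_spectrum_inv_iff :
    0 ∈ _root_.spectrum ℝ A.inv ↔ ¬ IsBoundedOperator A.op := by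
  rw [spectrum.zero_mem_iff, A.isBoundedInverse_inv.isUnit_iff]

theorem ofReal_mem_spectrum_op_iff {s : ℝ} :
    (s : ℂ) ∈ spectrum A.op ↔ 0 < s ∧ s⁻¹ ∈ _root_.spectrum ℝ A.inv := by
  rcases eq_or_ne s 0 with rfl | hs
  · simpa [spectrum] using A.isBoundedInverse_inv.zero_mem_resolventSet
  · have hmem : (s : ℂ) ∈ spectrum A.op ↔ s⁻¹ ∈ _root_.spectrum ℝ A.inv := by
      rw [← _root_.spectrum.algebraMap_mem_iff ℂ, _root_.spectrum.mem_iff, spectrum,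
        Set.mem_compl_iff, A.isBoundedInverse_inv.mem_resolventSet_iff (mod_cast hs)]
      simp
    rw [hmem, iff_and_self]
    exact fun h => (_root_.inv_nonneg.mp (spectrum_nonneg_of_nonneg A.inv_nonneg h)).lt_of_ne' hs

theorem generator_bijective_iff :
    Function.Bijective (fun z : (A.generator θ).domain => A.generator θ z) ↔
      (0 : ℂ) ∉ spectrum (A.generator θ) := by
  rw [bijective_iff_existsUnique_mem_graph, spectrum, Set.notMem_compl_iff,
    A.resolventSet_generator_tfae.out 0 1 rfl rfl, neg_surjective.forall]
  simp

theorem mem_spectrum_generator_iff : ξ ∈ spectrum (A.generator θ) ↔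
    (∃ s : ℝ, (s : ℂ) ∈ spectrum A.op ∧ (ξ = xiPlus θ s ∨ ξ = xiMinus θ s)) ∨
      ¬ IsBoundedOperator A.op ∧ (θ = 1 ∧ ξ = -1 ∨ 1 < θ ∧ ξ = 0) := by
  rw [spectrum, Set.mem_compl_iff, A.resolventSet_generator_tfae.out 0 2 rfl rfl,
    A.isUnit_pencil_iff]
  push Not
  constructor
  · rintro ⟨x, hx, hzero⟩
    rcases (spectrum_nonneg_of_nonneg A.inv_nonneg hx).eq_or_lt with rfl | hpos
    · exact .inr ⟨A.zero_mem_spectrum_inv_iff.mp hx, pencilSymbol_zero_eq_zero_iff.mp hzero⟩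
    · exact .inl ⟨x⁻¹, A.ofReal_mem_spectrum_op_iff.mpr ⟨inv_pos.mpr hpos, by rwa [inv_inv]⟩,
        (pencilSymbol_eq_zero_iff_of_pos hpos).mp hzero⟩
  · rintro (⟨s, hs, hξ⟩ | ⟨hA, hξ⟩)
    · obtain ⟨hpos, hmem⟩ := A.ofReal_mem_spectrum_op_iff.mp hs
      exact ⟨s⁻¹, hmem, (pencilSymbol_eq_zero_iff_of_pos (inv_pos.mpr hpos)).mpr (by rwa [inv_inv])⟩
    · exact ⟨0, A.zero_mem_spectrum_inv_iff.mpr hA, pencilSymbol_zero_eq_zero_iff.mpr hξ⟩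

theorem zero_mem_spectrum_generator_iff :
    0 ∈ spectrum (A.generator θ) ↔ 1 < θ ∧ ¬ IsBoundedOperator A.op := by
  have hroots : ¬ ∃ s : ℝ, (s : ℂ) ∈ spectrum A.op ∧ (0 = xiPlus θ s ∨ 0 = xiMinus θ s) :=
    fun ⟨_, hs, h⟩ =>
      ne_zero_of_eq_xiPlus_or_eq_xiMinus (A.ofReal_mem_spectrum_op_iff.mp hs).1 h rfl
  simp [A.mem_spectrum_generator_iff, hroots, and_comm]

theorem spectrum_generator_diff_singleton_zero :
    spectrum (A.generator θ) \ {0} =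
      (⋃ s ∈ {s : ℝ | (s : ℂ) ∈ spectrum A.op}, {xiPlus θ s, xiMinus θ s}) ∪
        {ξ | (θ = 1 ∧ ¬ IsBoundedOperator A.op) ∧ ξ = -1} := by
  ext ξ
  simp only [Set.mem_sdiff, Set.mem_singleton_iff, A.mem_spectrum_generator_iff, Set.mem_union,
    Set.mem_iUnion, Set.mem_ofPred_eq, Set.mem_insert_iff, exists_prop]
  constructor
  · rintro ⟨hroot | ⟨hA, ⟨hθ, hξ⟩ | ⟨-, hξ⟩⟩, hne⟩
    · exact .inl hroot
    · exact .inr ⟨⟨hθ, hA⟩, hξ⟩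
    · exact absurd hξ hne
  · rintro (⟨s, hs, hξ⟩ | ⟨hcase, rfl⟩)
    · exact ⟨.inl ⟨s, hs, hξ⟩,
        ne_zero_of_eq_xiPlus_or_eq_xiMinus (A.ofReal_mem_spectrum_op_iff.mp hs).1 hξ⟩
    · exact ⟨.inr ⟨hcase.2, .inl ⟨hcase.1, rfl⟩⟩, neg_ne_zero.mpr one_ne_zero⟩

end StrictlyPositiveOperator

end DampedWave

end

theorem mainTheorem11 {H : Type*} [NormedAddCommGroup H] [InnerProductSpace ℂ H] [CompleteSpace H]
    (A : DampedWave.StrictlyPositiveOperator H) (θ : ℝ) :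
    (Function.Bijective (fun z : (A.generator θ).domain => A.generator θ z) ↔
      θ ≤ 1 ∨ DampedWave.IsBoundedOperator A.op) ∧
    (θ = 1 ∧ ¬ DampedWave.IsBoundedOperator A.op →
      DampedWave.spectrum (A.generator θ) \ {0} =
        (⋃ s ∈ {s : ℝ | (s : ℂ) ∈ DampedWave.spectrum A.op},
          {DampedWave.xiPlus θ s, DampedWave.xiMinus θ s}) ∪ {-1}) ∧
    (¬ (θ = 1 ∧ ¬ DampedWave.IsBoundedOperator A.op) →
      DampedWave.spectrum (A.generator θ) \ {0} =
        ⋃ s ∈ {s : ℝ | (s : ℂ) ∈ DampedWave.spectrum A.op},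
          {DampedWave.xiPlus θ s, DampedWave.xiMinus θ s}) := by
  refine ⟨?_, fun hcase => ?_, fun hcase => ?_⟩
  · rw [A.generator_bijective_iff, A.zero_mem_spectrum_generator_iff, not_and_or, not_lt, not_not]
  · simp only [A.spectrum_generator_diff_singleton_zero, hcase, not_false_eq_true, and_self,
      true_and, Set.ofPred_eq_eq_singleton]
  · simp only [A.spectrum_generator_diff_singleton_zero, hcase, false_and, Set.ofPred_false,
      Set.union_empty]
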